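/- Let $K$ be a field, $R=K[x_1,\dots,x_n]$ the polynomial ring with its standard grading ($\deg x_i=1$), and $I\subset R$ a graded ideal such that $R/I$ is Cohen–Macaulay of codimension two, i.e. $\dim R-\dim R/I=2$. Let $$\cdots\to\bigoplus_{j\in\mathbb Z}R(-j)^{\beta_{2,j}}\to\bigoplus_{j\in\mathbb Z}R(-j)^{\beta_{1,j}}\to R\to 0$$ be the minimal graded free resolution of $R/I$, and for $i=1,2$ put $m_i=\min\{j:\beta_{i,j}\neq0\}$ and $M_i=\max\{j:\beta_{i,j}\neq0\}$. Let $e(R/I)$ be the multiplicity of $R/I$, that is, $e(R/I)=Q(1)$ where $\sum_{t\ge0}\dim_K(R/I)_t\,z^t=Q(z)/(1-z)^{d}$ with $d=\dim R/I$ and $Q\in\mathbb Z[z]$. Then $$e(R/I)\ \ge\ \tfrac12 m_1m_2+\tfrac12(M_2-M_1)(M_2-m_2+M_1-m_1)$$ and $$e(R/I)\ \le\ \tfrac12 M_1M_2-\tfrac12(m_2-m_1)(M_2-m_2+M_1-m_1).$$ -/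

import Mathlib

namespace GradedAlgebraBounds

open MvPolynomial

variable {K : Type*} [Field K] {n : ℕ}

/-- The homogeneous maximal ideal `(x₁, …, xₙ)` of `R = K[x₁, …, xₙ]`. -/
noncomputable def maxIdeal (K : Type*) [Field K] (n : ℕ) : Ideal (MvPolynomial (Fin n) K) :=
  Ideal.span (Set.range X)

attribute [local instance] MvPolynomial.gradedAlgebra in
/-- `I` is a graded ideal for the standard grading `deg xᵢ = 1`. -/
def IsGraded (I : Ideal (MvPolynomial (Fin n) K)) : Prop :=
  I.IsHomogeneous (homogeneousSubmodule (Fin n) K)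

/-- `R/I` has codimension `c`: `dim R - dim R/I = c`.
(The zero ring has dimension `⊥` and therefore no codimension.) -/
def HasCodim (I : Ideal (MvPolynomial (Fin n) K)) (c : ℕ) : Prop :=
  ringKrullDim (MvPolynomial (Fin n) K ⧸ I) + c = ringKrullDim (MvPolynomial (Fin n) K)

/-- The graded algebra `R/I` is Cohen–Macaulay: its depth, i.e. the maximal length of an
`R/I`-regular sequence in `(x₁, …, xₙ)`, equals its Krull dimension. As the depth never exceeds
the dimension, this says that there is a regular sequence of length `dim R/I`. -/
def IsCohenMacaulay (I : Ideal (MvPolynomial (Fin n) K)) : Prop :=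
  ∃ rs : List (MvPolynomial (Fin n) K), (∀ r ∈ rs, r ∈ maxIdeal K n) ∧
    RingTheory.Sequence.IsRegular (MvPolynomial (Fin n) K ⧸ I) rs ∧
    ringKrullDim (MvPolynomial (Fin n) K ⧸ I) = (rs.length : ℕ)

/-- The component `(R/I)_t`, the image of the forms of degree `t`. -/
noncomputable def component (I : Ideal (MvPolynomial (Fin n) K)) (t : ℕ) :
    Submodule K (MvPolynomial (Fin n) K ⧸ I) :=
  (homogeneousSubmodule (Fin n) K t).map (Ideal.Quotient.mkₐ K I).toLinearMap

/-- The Hilbert series `∑ₜ dim_K (R/I)_t z^t`. -/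
noncomputable def hilbertSeries (I : Ideal (MvPolynomial (Fin n) K)) : PowerSeries ℤ :=
  PowerSeries.mk fun t => (Module.finrank K (component I t) : ℤ)

/-- `e` is the multiplicity `e(R/I)`: the Hilbert series is `Q(z) / (1 - z)^d` with
`d = dim R/I` and a polynomial `Q`, and `e = Q(1)`. For `d > 0` this is `(d - 1)!` times the
leading coefficient of the Hilbert polynomial, and for `d = 0` it is `dim_K R/I`. -/
def HasMultiplicity (I : Ideal (MvPolynomial (Fin n) K)) (e : ℤ) : Prop :=
  ∃ (d : ℕ) (Q : Polynomial ℤ), ringKrullDim (MvPolynomial (Fin n) K ⧸ I) = d ∧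
    (1 - PowerSeries.X) ^ d * hilbertSeries I = (Q : PowerSeries ℤ) ∧ e = Q.eval 1

theorem HasMultiplicity.unique {I : Ideal (MvPolynomial (Fin n) K)} {e e' : ℤ}
    (h : HasMultiplicity I e) (h' : HasMultiplicity I e') : e = e' := by
  obtain ⟨d, Q, hd, hQ, rfl⟩ := h
  obtain ⟨d', Q', hd', hQ', rfl⟩ := h'
  have hdd : d = d' := by
    have h := hd.symm.trans hd'
    exact_mod_cast h
  subst hdd
  rw [Polynomial.coe_injective ℤ (hQ.symm.trans hQ')]

/-- A minimal graded free resolution `⋯ → F₂ → F₁ → F₀ = R` of `R/I`, where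
`Fᵢ = ⨁ₖ R(-shift i k)` has finite rank `rank i` and the map `Fᵢ₊₁ → Fᵢ` is given by
the matrix `d i`. -/
structure MinimalGradedFreeResolution (I : Ideal (MvPolynomial (Fin n) K)) where
  rank : ℕ → ℕ
  shift : ∀ i, Fin (rank i) → ℤ
  d : ∀ i, Matrix (Fin (rank i)) (Fin (rank (i + 1))) (MvPolynomial (Fin n) K)
  rank_zero : rank 0 = 1
  shift_zero : ∀ j, shift 0 j = 0
  /-- The maps are homogeneous of degree `0`: every nonzero entry is a form of the degree
  prescribed by the shifts. -/
  homogeneous : ∀ i j k, d i j k ≠ 0 →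
    ∃ a : ℕ, shift (i + 1) k - shift i j = a ∧ (d i j k).IsHomogeneous a
  /-- The image of `F₁ → F₀ = R` is `I`, so that the cokernel is `R/I`. -/
  span_eq : ∀ j, Ideal.span (Set.range (d 0 j)) = I
  exact : ∀ i, Function.Exact (d (i + 1)).mulVecLin (d i).mulVecLin
  minimal : ∀ i j k, d i j k ∈ maxIdeal K n

namespace MinimalGradedFreeResolution

variable {I : Ideal (MvPolynomial (Fin n) K)} (F : MinimalGradedFreeResolution I)

/-- The graded Betti number `β_{i,j}`: the number of summands `R(-j)` of `Fᵢ`. -/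
def betti (i : ℕ) (j : ℤ) : ℕ :=
  (Finset.univ.filter fun k => F.shift i k = j).card

/-- `mᵢ`, the minimum of `{j | β_{i,j} ≠ 0}` (a finite set, nonempty when `Fᵢ ≠ 0`). -/
noncomputable def minShift (i : ℕ) : ℤ := sInf {j | F.betti i j ≠ 0}

/-- `Mᵢ`, the maximum of `{j | β_{i,j} ≠ 0}` (a finite set, nonempty when `Fᵢ ≠ 0`). -/
noncomputable def maxShift (i : ℕ) : ℤ := sSup {j | F.betti i j ≠ 0}

end MinimalGradedFreeResolution

end GradedAlgebraBounds

/-! Write 𝔪 for the ideal of the variables, and a_i, b_k for the shifts of F₁ and F₂. A regular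
sequence of length n - 2 on R/I forces F₃ = 0 (`rank_eq_zero`). Hence the Hilbert series is
P(z)/(1-z)^n with P = 1 - ∑ z^{a_i} + ∑ z^{b_k} (`one_sub_pow_mul_hilbertSeries`). Since dim R/I = n
- 2 bounds the growth of the Hilbert function, (1-z)² divides P (`one_sub_X_sq_dvd_of_growth`).
Evaluating P, P', P'' at 1 shows that there is one more a than b, that ∑ a_i = ∑ b_k, and that 2e =
∑ b_k² - ∑ a_i² (`numerical_conditions`).

Sort both families increasingly, counting from 0. Then a_{k+1} < b_k: otherwise degrees would
confine the first k+1 columns of the injective matrix `d 1` to k+1 rows, which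
`card_lt_of_supported` forbids. As ∑ (b_k - a_{k+1}) = a_0, one gets 2e - a_0 b_0 = ∑ (b_k -
a_{k+1})(b_k + a_{k+1} - a_0 - b_0). All terms are nonnegative, and keeping only the last gives the
lower bound. Pairing b_k with a_k and keeping only the first term gives the upper bound
(`sum_sq_sub_sum_sq_bounds`). -/

namespace GradedAlgebraBounds

/-! ### Exact complexes of free modules, regular sequences and mapping cones. -/

section FreeComplexes

open scoped Pointwise

universe u

variable {R : Type*} [CommRing R]

theorem _root_.Module.Basis.mem_ideal_smul_top_iff {ι M : Type*} [AddCommGroup M] [Module R M]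
    (b : Module.Basis ι R M) (J : Ideal R) (w : M) :
    w ∈ J • (⊤ : Submodule R M) ↔ ∀ i, b.repr w i ∈ J := by
  constructor
  · intro hw i
    refine Submodule.smul_induction_on hw (fun r hr v _ => ?_) (fun v v' hv hv' => ?_)
    · simpa using J.mul_mem_right _ hr
    · simpa using J.add_mem hv hv'
  · intro h
    rw [← b.linearCombination_repr w, Finsupp.linearCombination_apply, Finsupp.sum]
    exact Submodule.sum_mem _ fun i _ => Submodule.smul_mem_smul (h i) trivial

theorem mem_ideal_smul_top_of_smul_mem {M : Type*} [AddCommGroup M] [Module R M]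
    [Module.Free R M] {J : Ideal R} {x : R} (hx : ∀ a, x * a ∈ J → a ∈ J) {w : M}
    (hw : x • w ∈ J • (⊤ : Submodule R M)) : w ∈ J • (⊤ : Submodule R M) := by
  let b := Module.Free.chooseBasis R M
  rw [b.mem_ideal_smul_top_iff] at hw ⊢
  exact fun i => hx _ (by simpa using hw i)

theorem map_mem_ideal_smul_top {M N : Type*} [AddCommGroup M] [Module R M] [AddCommGroup N]
    [Module R N] (f : M →ₗ[R] N) {J : Ideal R} {w : M} (hw : w ∈ J • (⊤ : Submodule R M)) :
    f w ∈ J • (⊤ : Submodule R N) := by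
  have h : f w ∈ (J • (⊤ : Submodule R M)).map f := Submodule.mem_map_of_mem hw
  rw [Submodule.map_smul''] at h
  exact Submodule.smul_mono le_rfl le_top h

theorem prod_mem_ideal_smul_top {M N : Type*} [AddCommGroup M] [Module R M] [AddCommGroup N]
    [Module R N] {J : Ideal R} {v : M} {w : N} (hv : v ∈ J • (⊤ : Submodule R M))
    (hw : w ∈ J • (⊤ : Submodule R N)) : (v, w) ∈ J • (⊤ : Submodule R (M × N)) := by
  simpa using Submodule.add_mem _ (map_mem_ideal_smul_top (LinearMap.inl R M N) hv)
    (map_mem_ideal_smul_top (LinearMap.inr R M N) hw)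

theorem mem_span_singleton_sup_smul_top {M : Type*} [AddCommGroup M] [Module R M]
    {J : Ideal R} {x : R} {w : M} (hw : w ∈ (J ⊔ Ideal.span {x}) • (⊤ : Submodule R M)) :
    ∃ u ∈ J • (⊤ : Submodule R M), ∃ v : M, w = u + x • v := by
  rw [Submodule.sup_smul, Submodule.mem_sup] at hw
  obtain ⟨u, hu, v, hv, rfl⟩ := hw
  rw [Submodule.ideal_span_singleton_smul] at hv
  obtain ⟨v, -, rfl⟩ := (Submodule.mem_smul_pointwise_iff_exists _ _ _).1 hv
  exact ⟨u, hu, v, rfl⟩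

/-- Reduction of an exact complex of free modules modulo a regular sequence `x₀, x₁, …`, with
`J k` the ideal generated by the first `k` elements: exactness survives in degrees `> k`. -/
theorem exact_mod_of_regular {C : ℕ → Type*} [∀ i, AddCommGroup (C i)] [∀ i, Module R (C i)]
    [∀ i, Module.Free R (C i)] (d : ∀ i, C (i + 1) →ₗ[R] C i)
    (hd : ∀ i, Function.Exact (d (i + 1)) (d i)) (x : ℕ → R) (J : ℕ → Ideal R) (hJ0 : J 0 = ⊥)
    (hJ : ∀ k, J (k + 1) = J k ⊔ Ideal.span {x k}) (N : ℕ)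
    (hx : ∀ k < N, ∀ a, x k * a ∈ J k → a ∈ J k) (k : ℕ) (hk : k ≤ N) (i : ℕ) (hi : k ≤ i)
    (v : C (i + 1)) (hv : d i v ∈ J k • (⊤ : Submodule R (C i))) :
    ∃ w, v - d (i + 1) w ∈ J k • (⊤ : Submodule R (C (i + 1))) := by
  induction k generalizing i with
  | zero =>
    rw [hJ0, Submodule.bot_smul, Submodule.mem_bot] at hv
    obtain ⟨w, rfl⟩ := (hd i v).1 hv
    exact ⟨w, by simp⟩
  | succ k ih =>
    obtain ⟨i, rfl⟩ : ∃ j, i = j + 1 := ⟨i - 1, by omega⟩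
    rw [hJ] at hv
    -- Applying `d` to `d v = u + x k • w` puts `x k • d w` in `J k • C`, so `w` is a cycle modulo
    -- `J k`. If it bounds `w'`, then `v - x k • w'` is again a cycle modulo `J k`.
    obtain ⟨u, hu, w, hw⟩ := mem_span_singleton_sup_smul_top hv
    have h1 : d i w ∈ J k • (⊤ : Submodule R (C i)) := by
      apply mem_ideal_smul_top_of_smul_mem (hx k (by omega))
      have h2 : d i (d (i + 1) v) = 0 := (hd i).apply_apply_eq_zero v
      rw [hw, map_add, map_smul] at h2
      rw [eq_neg_of_add_eq_zero_right h2]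
      exact neg_mem (map_mem_ideal_smul_top _ hu)
    obtain ⟨w', hw'⟩ := ih (by omega) i (by omega) w h1
    obtain ⟨w'', hw''⟩ := ih (by omega) (i + 1) (by omega) (v - x k • w') (by
      rw [map_sub, map_smul, hw, add_sub_assoc, ← smul_sub]
      exact add_mem hu (Submodule.smul_mem _ _ hw'))
    refine ⟨w'', ?_⟩
    rw [hJ, Submodule.sup_smul, Submodule.mem_sup]
    refine ⟨_, hw'', x k • w', Submodule.smul_mem_smul (Ideal.mem_span_singleton_self _) trivial,
      ?_⟩
    abel

/-- The shift `C[-1]` of a sequence of modules. -/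
abbrev Shifted (C : ℕ → Type u) : ℕ → Type u
  | 0 => PUnit.{u + 1}
  | i + 1 => C i

instance (C : ℕ → Type u) [∀ i, AddCommGroup (C i)] : ∀ i, AddCommGroup (Shifted C i)
  | 0 => (inferInstance : AddCommGroup PUnit.{u + 1})
  | i + 1 => (inferInstance : AddCommGroup (C i))

instance (C : ℕ → Type u) [∀ i, AddCommGroup (C i)] [∀ i, Module R (C i)] :
    ∀ i, Module R (Shifted C i)
  | 0 => (inferInstance : Module R PUnit.{u + 1})
  | i + 1 => (inferInstance : Module R (C i))

instance (C : ℕ → Type u) [∀ i, AddCommGroup (C i)] [∀ i, Module R (C i)]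
    [∀ i, Module.Free R (C i)] : ∀ i, Module.Free R (Shifted C i)
  | 0 => (inferInstance : Module.Free R PUnit.{u + 1})
  | i + 1 => (inferInstance : Module.Free R (C i))

/-- The differential of `C`, as a map from `C` to its shift. -/
def toShifted {C : ℕ → Type u} [∀ i, AddCommGroup (C i)] [∀ i, Module R (C i)]
    (d : ∀ i, C (i + 1) →ₗ[R] C i) : ∀ i, C i →ₗ[R] Shifted C i
  | 0 => 0
  | i + 1 => d i

/-- The differential of the mapping cone of multiplication by `r`. -/
def coneMap {C : ℕ → Type u} [∀ i, AddCommGroup (C i)] [∀ i, Module R (C i)]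
    (d : ∀ i, C (i + 1) →ₗ[R] C i) (r : R) (i : ℕ) : C (i + 1) × C i →ₗ[R] C i × Shifted C i :=
  ((d i).coprod (r • LinearMap.id)).prod (-(toShifted d i).comp (LinearMap.snd R _ _))

theorem coneMap_apply {C : ℕ → Type u} [∀ i, AddCommGroup (C i)] [∀ i, Module R (C i)]
    (d : ∀ i, C (i + 1) →ₗ[R] C i) (r : R) (i : ℕ) (a : C (i + 1)) (b : C i) :
    coneMap d r i (a, b) = (d i a + r • b, -toShifted d i b) := rfl

/-- Long exact sequence of the cone: as `C` is acyclic in positive degrees, the only obstruction is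
the kernel of `r` on the cokernel of `d 0`, which `hr` excludes. -/
theorem coneMap_exact {C : ℕ → Type u} [∀ i, AddCommGroup (C i)] [∀ i, Module R (C i)]
    (d : ∀ i, C (i + 1) →ₗ[R] C i) (hd : ∀ i, Function.Exact (d (i + 1)) (d i)) (r : R)
    (hr : ∀ b : C 0, r • b ∈ LinearMap.range (d 0) → b ∈ LinearMap.range (d 0)) (i : ℕ) :
    Function.Exact (coneMap d r (i + 1)) (coneMap d r i) := by
  rintro ⟨a, (b : C i)⟩
  rw [coneMap_apply]
  constructor
  · intro h
    obtain ⟨h1, h2⟩ := Prod.mk.inj h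
    obtain ⟨c, hc⟩ : ∃ c, d i c = b := by
      cases i with
      | zero => exact hr b ⟨-a, by rw [map_neg]; exact neg_eq_of_add_eq_zero_right h1⟩
      | succ i => exact (hd i b).1 (neg_eq_zero.1 h2)
    have h3 : d i (a + r • c) = 0 := by rw [map_add, map_smul, hc]; exact h1
    obtain ⟨e, he⟩ := (hd i _).1 h3
    refine ⟨(e, -c), ?_⟩
    have h4 : d (i + 1) e + r • -c = a := by rw [he]; simp
    have h5 : -d i (-c) = b := by rw [map_neg, neg_neg, hc]
    exact Prod.ext h4 h5
  · rintro ⟨⟨e, c⟩, hec⟩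
    obtain ⟨h1, h2⟩ := Prod.mk.inj hec
    have h2' : -d i c = b := h2
    subst h2' h1
    refine Prod.ext ?_ ?_
    · simp [(hd i).apply_apply_eq_zero e]
    · cases i with
      | zero => rfl
      | succ i =>
        change -d i (-d (i + 1) c) = 0
        simp [(hd i).apply_apply_eq_zero c]

/-- Let `C` be an exact complex of free modules with differentials vanishing modulo `𝔪`, where
`𝔪 = J N` is generated by a regular sequence of length `N`. If the module `M` resolved by `C` has
a weakly regular sequence of length `s` in `𝔪`, then `C i` vanishes modulo `𝔪` for `i > N - s`. -/
theorem minimal_complex_vanishing (x : ℕ → R) (J : ℕ → Ideal R) (hJ0 : J 0 = ⊥)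
    (hJ : ∀ k, J (k + 1) = J k ⊔ Ideal.span {x k}) (N : ℕ)
    (hx : ∀ k < N, ∀ a, x k * a ∈ J k → a ∈ J k) (rs : List R) (hrs : ∀ r ∈ rs, r ∈ J N)
    {C : ℕ → Type u} [∀ i, AddCommGroup (C i)] [∀ i, Module R (C i)]
    [∀ i, Module.Free R (C i)] (d : ∀ i, C (i + 1) →ₗ[R] C i)
    (hd : ∀ i, Function.Exact (d (i + 1)) (d i))
    (hmin : ∀ i v, d i v ∈ J N • (⊤ : Submodule R (C i)))
    {M : Type*} [AddCommGroup M] [Module R M] (ε : C 0 →ₗ[R] M) (hε : Function.Surjective ε)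
    (hdε : Function.Exact (d 0) ε) (hM : RingTheory.Sequence.IsWeaklyRegular M rs)
    (i : ℕ) (hi : N < i + rs.length) (v : C i) : v ∈ J N • (⊤ : Submodule R (C i)) := by
  induction rs generalizing C M i with
  | nil =>
    obtain ⟨i, rfl⟩ : ∃ j, i = j + 1 := ⟨i - 1, by simp at hi; omega⟩
    -- By minimality `v` is a cycle modulo 𝔪, hence a boundary modulo 𝔪 in degrees above `N`;
    -- boundaries vanish modulo 𝔪, again by minimality.
    obtain ⟨w, hw⟩ := exact_mod_of_regular d hd x J hJ0 hJ N hx N le_rfl i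
      (by simp at hi; omega) v (hmin i v)
    simpa using add_mem hw (hmin (i + 1) w)
  | cons r rs ih =>
    rw [RingTheory.Sequence.isWeaklyRegular_cons_iff] at hM
    have hr : ∀ b : C 0, r • b ∈ LinearMap.range (d 0) → b ∈ LinearMap.range (d 0) := by
      rintro b ⟨c, hc⟩
      refine (hdε b).1 (hM.1 ?_)
      have h : ε (r • b) = 0 := hc ▸ hdε.apply_apply_eq_zero c
      simpa using h
    have hrJ : r ∈ J N := hrs r (by simp)
    let ε' : C 0 × Shifted C 0 →ₗ[R] QuotSMulTop r M :=
      (Submodule.mkQ _).comp (ε.comp (LinearMap.fst R _ _))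
    -- The cone of `r` resolves `M / rM`, stays minimal because `r ∈ J N`, and contains `C i` as a
    -- summand in degree `i + 1`. The sequence gets shorter by one as the degree goes up by one.
    have h := ih (fun s hs => hrs s (by simp [hs])) (C := fun i => C i × Shifted C i)
      (coneMap d r) (coneMap_exact d hd r hr)
      (fun i ⟨a, b⟩ => prod_mem_ideal_smul_top
        (add_mem (hmin i a) (Submodule.smul_mem_smul hrJ trivial)) (neg_mem (by
          cases i with
          | zero => exact zero_mem _
          | succ i => exact hmin i b)))
      ε' ((Submodule.mkQ_surjective _).comp (hε.comp Prod.fst_surjective)) ?_ hM.2 (i + 1)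
      (by simp at hi; omega) (0, v)
    · exact map_mem_ideal_smul_top (LinearMap.snd R (C (i + 1)) (C i)) h
    · rintro ⟨a, b⟩
      have h0 : ε' (a, b) = 0 ↔ ε a ∈ r • (⊤ : Submodule R M) :=
        Submodule.Quotient.mk_eq_zero (r • (⊤ : Submodule R M))
      rw [h0, Submodule.mem_smul_pointwise_iff_exists]
      constructor
      · rintro ⟨m, -, hm⟩
        obtain ⟨c, rfl⟩ := hε m
        obtain ⟨e, he⟩ := (hdε (a - r • c)).1 (by rw [map_sub, map_smul, hm, sub_self])
        exact ⟨(e, c), Prod.ext (by rw [coneMap_apply, he]; simp) rfl⟩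
      · rintro ⟨⟨e, c⟩, hec⟩
        have h1 : d 0 e + r • c = a := (Prod.mk.inj hec).1
        exact ⟨ε c, trivial, by rw [← h1, map_add, hdε.apply_apply_eq_zero, zero_add, map_smul]⟩

end FreeComplexes

end GradedAlgebraBounds

/-! ### The variables as a regular sequence; length and matrices of the resolution. -/

namespace GradedAlgebraBounds

open MvPolynomial

section Variables

variable (K : Type*) [Field K] (n : ℕ)

/-- The variable `X k`, extended by `0` for `k ≥ n`. -/
noncomputable def varSeq (k : ℕ) : MvPolynomial (Fin n) K := if h : k < n then X ⟨k, h⟩ else 0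

/-- The ideal generated by the first `k` variables. -/
noncomputable def varIdeal (k : ℕ) : Ideal (MvPolynomial (Fin n) K) :=
  Ideal.span (X '' {i : Fin n | i.val < k})

theorem varIdeal_zero : varIdeal K n 0 = ⊥ := by simp [varIdeal]

theorem varIdeal_self : varIdeal K n n = maxIdeal K n := by
  have : {i : Fin n | i.val < n} = Set.univ := by ext i; simp
  rw [varIdeal, maxIdeal, this, Set.image_univ]

theorem varIdeal_succ (k : ℕ) :
    varIdeal K n (k + 1) = varIdeal K n k ⊔ Ideal.span {varSeq K n k} := by
  rw [varIdeal, varIdeal, varSeq]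
  split_ifs with h
  · have : {i : Fin n | i.val < k + 1} = {i : Fin n | i.val < k} ∪ {⟨k, h⟩} := by
      ext i
      simp only [Set.mem_ofPred_eq, Set.mem_union, Set.mem_singleton_iff, Fin.ext_iff]
      omega
    rw [this, Set.image_union, Ideal.span_union, Set.image_singleton]
  · have : {i : Fin n | i.val < k + 1} = {i : Fin n | i.val < k} := by
      ext i
      simp only [Set.mem_ofPred_eq]
      omega
    rw [this]
    simp

/-- Membership is tested monomial by monomial, and multiplication by `X k` leaves the exponents of
the earlier variables unchanged. -/
theorem mem_varIdeal_of_varSeq_mul_mem {k : ℕ} (hk : k < n) (a : MvPolynomial (Fin n) K)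
    (ha : varSeq K n k * a ∈ varIdeal K n k) : a ∈ varIdeal K n k := by
  rw [varSeq, dif_pos hk, varIdeal, mem_ideal_span_X_image] at ha
  rw [varIdeal, mem_ideal_span_X_image]
  intro m hm
  obtain ⟨i, hi, hi'⟩ := ha (Finsupp.single ⟨k, hk⟩ 1 + m) (by
    rw [mem_support_iff, coeff_X_mul]
    exact mem_support_iff.1 hm)
  refine ⟨i, hi, ?_⟩
  have hne : (⟨k, hk⟩ : Fin n) ≠ i := by
    rintro rfl
    exact absurd hi (by simp)
  simpa [Finsupp.single_apply, hne] using hi'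

theorem one_notMem_maxIdeal : (1 : MvPolynomial (Fin n) K) ∉ maxIdeal K n := by
  intro h
  rw [maxIdeal, ← Set.image_univ, mem_ideal_span_X_image] at h
  obtain ⟨i, -, hi⟩ := h 0 (by simp)
  exact hi rfl

theorem eq_zero_of_mem_maxIdeal_of_isHomogeneous_zero {f : MvPolynomial (Fin n) K}
    (hf : f ∈ maxIdeal K n) (h0 : f.IsHomogeneous 0) : f = 0 := by
  obtain ⟨c, rfl⟩ : ∃ c, f = C c := ⟨_, (totalDegree_eq_zero_iff_eq_C.1
    (Nat.le_zero.1 h0.totalDegree_le))⟩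
  by_contra hc
  have hc' : c ≠ 0 := fun h => hc (by rw [h, C_0])
  refine one_notMem_maxIdeal K n ?_
  have := (maxIdeal K n).mul_mem_left (C c⁻¹) hf
  rwa [← C_mul, inv_mul_cancel₀ hc', C_1] at this

end Variables

namespace MinimalGradedFreeResolution

variable {K : Type*} [Field K] {n : ℕ} {I : Ideal (MvPolynomial (Fin n) K)}
  (F : MinimalGradedFreeResolution I)

/-- The index of the summand `R` of `F₀`. -/
def zeroIndex : Fin (F.rank 0) := ⟨0, by rw [F.rank_zero]; exact one_pos⟩

theorem eq_zeroIndex (j : Fin (F.rank 0)) : j = F.zeroIndex := by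
  have h : Subsingleton (Fin (F.rank 0)) := by rw [F.rank_zero]; infer_instance
  exact Subsingleton.elim _ _

/-- The generators of `I` given by `F`. -/
def gen (i : Fin (F.rank 1)) : MvPolynomial (Fin n) K := F.d 0 F.zeroIndex i

theorem span_range_gen : Ideal.span (Set.range F.gen) = I := F.span_eq F.zeroIndex

theorem mulVecLin_zero_apply (v : Fin (F.rank 1) → MvPolynomial (Fin n) K) (j) :
    (F.d 0).mulVecLin v j = ∑ i, F.gen i * v i := by
  rw [F.eq_zeroIndex j]
  rfl

theorem mem_iff_exists_mulVecLin {f : MvPolynomial (Fin n) K} :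
    f ∈ I ↔ ∃ v, (F.d 0).mulVecLin v F.zeroIndex = f := by
  have h : f ∈ I ↔ f ∈ Ideal.span (Set.range F.gen) := by rw [F.span_range_gen]
  rw [h, Ideal.mem_span_range_iff_exists_fun]
  simp only [mulVecLin_zero_apply, mul_comm]

theorem mulVecLin_apply (i : ℕ) (v : Fin (F.rank (i + 1)) → MvPolynomial (Fin n) K) (j) :
    (F.d i).mulVecLin v j = ∑ k, F.d i j k * v k := rfl

theorem mulVecLin_mem (i : ℕ) (v : Fin (F.rank (i + 1)) → MvPolynomial (Fin n) K) (j) :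
    (F.d i).mulVecLin v j ∈ maxIdeal K n :=
  F.mulVecLin_apply i v j ▸
    Ideal.sum_mem _ fun k _ => (maxIdeal K n).mul_mem_right _ (F.minimal i j k)

theorem mem_ideal_smul_top_iff (J : Ideal (MvPolynomial (Fin n) K)) {m : ℕ}
    (v : Fin m → MvPolynomial (Fin n) K) :
    v ∈ J • (⊤ : Submodule (MvPolynomial (Fin n) K) (Fin m → MvPolynomial (Fin n) K)) ↔
      ∀ j, v j ∈ J := by
  rw [(Pi.basisFun _ _).mem_ideal_smul_top_iff]
  simp

/-- The projective dimension of `R/I` is at most `n - s` if `R/I` has a weakly regular sequence of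
length `s` in the maximal homogeneous ideal. -/
theorem rank_eq_zero {rs : List (MvPolynomial (Fin n) K)} (hrs : ∀ r ∈ rs, r ∈ maxIdeal K n)
    (hreg : RingTheory.Sequence.IsWeaklyRegular (MvPolynomial (Fin n) K ⧸ I) rs) {i : ℕ}
    (hi : n < i + rs.length) : F.rank i = 0 := by
  by_contra hne
  have h := minimal_complex_vanishing (varSeq K n) (varIdeal K n) (varIdeal_zero K n)
    (varIdeal_succ K n) n (fun k hk => mem_varIdeal_of_varSeq_mul_mem K n hk) rs
    (by rwa [varIdeal_self]) (C := fun i => Fin (F.rank i) → MvPolynomial (Fin n) K)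
    (fun i => (F.d i).mulVecLin) F.exact
    (fun i v => by
      rw [varIdeal_self, mem_ideal_smul_top_iff]
      exact F.mulVecLin_mem i v)
    ((Submodule.mkQ I).comp (LinearMap.proj F.zeroIndex))
    ((Submodule.mkQ_surjective I).comp (LinearMap.proj_surjective _)) ?_ hreg i hi
    -- If `F i` were nonzero, the all-ones vector could not lie in 𝔪 · `F i`.
    (fun _ => 1)
  · rw [varIdeal_self, mem_ideal_smul_top_iff] at h
    exact one_notMem_maxIdeal K n (h ⟨0, Nat.pos_of_ne_zero hne⟩)
  · intro v
    have h0 : ((Submodule.mkQ I).comp (LinearMap.proj F.zeroIndex)) v = 0 ↔ v F.zeroIndex ∈ I :=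
      Submodule.Quotient.mk_eq_zero I
    rw [h0, F.mem_iff_exists_mulVecLin]
    exact exists_congr fun w => ⟨fun hw => funext fun j => by rw [F.eq_zeroIndex j, hw],
      fun hw => congrFun hw _⟩

/-- A zero generator would make a unit vector of `F₁` a cycle, hence a boundary, while minimality
puts all boundaries in 𝔪F₁. -/
theorem gen_ne_zero (i : Fin (F.rank 1)) : F.gen i ≠ 0 := by
  intro h
  obtain ⟨w, hw⟩ := (F.exact 0 (Pi.single i 1)).1 (by
    funext j
    rw [mulVecLin_zero_apply, Finset.sum_eq_single i (fun k _ hk => by simp [hk])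
      (fun hk => absurd (Finset.mem_univ i) hk), h]
    simp)
  have h1 := F.mulVecLin_mem 1 w i
  have h2 : (F.d 1).mulVecLin w i = 1 := by
    have := congrFun hw i
    simpa using this
  rw [h2] at h1
  exact one_notMem_maxIdeal K n h1

theorem shift_one_pos (i : Fin (F.rank 1)) : 0 < F.shift 1 i := by
  obtain ⟨a, ha, hh⟩ := F.homogeneous 0 F.zeroIndex i (F.gen_ne_zero i)
  rw [F.shift_zero] at ha
  have ha0 : a ≠ 0 := by
    rintro rfl
    exact F.gen_ne_zero i (eq_zero_of_mem_maxIdeal_of_isHomogeneous_zero K n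
      (F.minimal 0 F.zeroIndex i) hh)
  change F.shift 1 i - 0 = a at ha
  omega

theorem shift_lt_of_d_ne_zero {i : ℕ} {j k} (h : F.d i j k ≠ 0) :
    F.shift i j < F.shift (i + 1) k := by
  obtain ⟨a, ha, hh⟩ := F.homogeneous i j k h
  have ha0 : a ≠ 0 := by
    rintro rfl
    exact h (eq_zero_of_mem_maxIdeal_of_isHomogeneous_zero K n (F.minimal i j k) hh)
  omega

theorem mulVecLin_one_injective (h3 : F.rank 3 = 0) :
    Function.Injective (F.d 1).mulVecLin := by
  rw [← LinearMap.ker_eq_bot, LinearMap.ker_eq_bot']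
  intro v hv
  obtain ⟨w, rfl⟩ := (F.exact 1 v).1 hv
  have : w = 0 := funext fun k => by
    exact absurd (lt_of_lt_of_eq k.isLt h3) (Nat.not_lt_zero _)
  rw [this, map_zero]

theorem sum_gen_mul_d_one (k : Fin (F.rank 2)) : ∑ i, F.gen i * F.d 1 i k = 0 := by
  have h := congrFun ((F.exact 0).apply_apply_eq_zero (Pi.single k 1)) F.zeroIndex
  rw [mulVecLin_zero_apply] at h
  simpa using h

/-- Positivity of the shifts makes `Int.toNat` harmless in `numerator`. -/
theorem shift_two_pos (h3 : F.rank 3 = 0) (k : Fin (F.rank 2)) : 0 < F.shift 2 k := by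
  obtain ⟨i, hi⟩ : ∃ i, F.d 1 i k ≠ 0 := by
    by_contra! h
    have : (Pi.single k 1 : Fin (F.rank 2) → MvPolynomial (Fin n) K) = 0 := by
      apply F.mulVecLin_one_injective h3
      funext i
      simp [h i]
    simpa using congrFun this k
  exact (F.shift_one_pos i).trans (F.shift_lt_of_d_ne_zero hi)

/-- A family of columns of `d 1` cannot be supported on a set of at most as many rows. -/
theorem card_lt_of_supported (h3 : F.rank 3 = 0) (S : Finset (Fin (F.rank 1)))
    (T : Finset (Fin (F.rank 2))) (hT : T.Nonempty)
    (h : ∀ i ∉ S, ∀ k ∈ T, F.d 1 i k = 0) : T.card < S.card := by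
  classical
  have hinj := F.mulVecLin_one_injective h3
  obtain ⟨k₀, hk₀⟩ := hT
  obtain ⟨i₀, hi₀⟩ : S.Nonempty := by
    rw [Finset.nonempty_iff_ne_empty]
    rintro rfl
    have : (Pi.single k₀ 1 : Fin (F.rank 2) → MvPolynomial (Fin n) K) = 0 := by
      apply hinj
      funext i
      simp [h i (by simp) k₀ hk₀]
    simpa using congrFun this k₀
  -- The columns in `T` together with one unit vector: pairing with the generators kills the columns
  -- but sends the unit vector to `gen i₀ ≠ 0`. Independence of this family gives `T.card + 1 ≤
  -- S.card`.
  let w : Option T → (S → MvPolynomial (Fin n) K) := fun o =>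
    o.elim (Pi.single ⟨i₀, hi₀⟩ 1) fun k i => F.d 1 i k
  have hw : LinearIndependent (MvPolynomial (Fin n) K) w := by
    rw [Fintype.linearIndependent_iff]
    intro c hc
    simp only [Fintype.sum_option] at hc
    have hrow : ∀ i : S, c none * (Pi.single (M := fun _ => MvPolynomial (Fin n) K) ⟨i₀, hi₀⟩ 1 i)
        + ∑ k : T, c (some k) * F.d 1 i k = 0 := by
      intro i
      have := congrFun hc i
      simpa [w, Finset.sum_apply] using this
    have hnone : c none = 0 := by
      have h1 : ∑ i : S, F.gen i * (c none *
          (Pi.single (M := fun _ => MvPolynomial (Fin n) K) ⟨i₀, hi₀⟩ 1 i)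
            + ∑ k : T, c (some k) * F.d 1 i k) = 0 :=
        Finset.sum_eq_zero fun i _ => by rw [hrow i, mul_zero]
      have h2 : ∀ k : T, ∑ i : S, F.gen i * F.d 1 i k = 0 := by
        intro k
        rw [← F.sum_gen_mul_d_one k, Finset.sum_coe_sort S (fun i => F.gen i * F.d 1 i k)]
        exact Finset.sum_subset (Finset.subset_univ S) fun i _ hi => by
          rw [h i hi k k.2, mul_zero]
      have h4 : ∑ i : S, F.gen i * ∑ k : T, c (some k) * F.d 1 i k = 0 := by
        simp only [Finset.mul_sum]
        rw [Finset.sum_comm]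
        refine Finset.sum_eq_zero fun k _ => ?_
        rw [← mul_zero (c (some k)), ← h2 k, Finset.mul_sum]
        exact Finset.sum_congr rfl fun i _ => by ring
      simp only [mul_add, Finset.sum_add_distrib] at h1
      rw [h4, add_zero, Finset.sum_eq_single ⟨i₀, hi₀⟩ (fun i _ hi => by simp [hi])
        (fun hi => absurd (Finset.mem_univ _) hi)] at h1
      simpa [F.gen_ne_zero] using h1
    have hsome : (fun k => if hk : k ∈ T then c (some ⟨k, hk⟩) else 0) =
        (0 : Fin (F.rank 2) → MvPolynomial (Fin n) K) := by
      apply hinj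
      rw [map_zero]
      funext i
      have h5 : (F.d 1).mulVecLin (fun k => if hk : k ∈ T then c (some ⟨k, hk⟩) else 0) i
          = ∑ k : T, c (some k) * F.d 1 i k := by
        rw [mulVecLin_apply, ← Finset.sum_subset (Finset.subset_univ T)
          (fun k _ hk => by simp [hk]), ← Finset.sum_coe_sort T]
        exact Finset.sum_congr rfl fun k _ => by simp [mul_comm]
      rw [h5]
      by_cases hi : i ∈ S
      · simpa [hnone] using hrow ⟨i, hi⟩
      · exact Finset.sum_eq_zero fun k _ => by rw [h i hi k k.2, mul_zero]
    rintro (_ | k)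
    · exact hnone
    · simpa using congrFun hsome k
  have := hw.fintype_card_le_finrank
  simpa using this

end MinimalGradedFreeResolution

end GradedAlgebraBounds

/-! ### Graded strands and the Hilbert series. -/

namespace GradedAlgebraBounds

open MvPolynomial

section DegreeParts

variable (K : Type*) [Field K] (n : ℕ)

/-- The forms of degree `u`, for an integer `u`. -/
noncomputable def degreePart (u : ℤ) : Submodule K (MvPolynomial (Fin n) K) :=
  if 0 ≤ u then homogeneousSubmodule (Fin n) K u.toNat else ⊥

/-- The projection to the component of degree `u`, for an integer `u`. -/
noncomputable def degreeProj (u : ℤ) : MvPolynomial (Fin n) K →ₗ[K] MvPolynomial (Fin n) K :=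
  if 0 ≤ u then homogeneousComponent u.toNat else 0

theorem degreeProj_mem (u : ℤ) (f : MvPolynomial (Fin n) K) :
    degreeProj K n u f ∈ degreePart K n u := by
  unfold degreeProj degreePart
  split_ifs
  · exact homogeneousComponent_mem _ _
  · simp

variable {K n}

theorem degreeProj_of_mem {u : ℤ} {f : MvPolynomial (Fin n) K} (hf : f ∈ degreePart K n u) :
    degreeProj K n u f = f := by
  unfold degreeProj
  unfold degreePart at hf
  split_ifs at hf ⊢
  · rw [homogeneousComponent_of_mem hf, if_pos rfl]
  · simpa using hf.symm

attribute [local instance] MvPolynomial.gradedAlgebra in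
theorem homogeneousComponent_mul_of_le {f : MvPolynomial (Fin n) K} {a : ℕ}
    (hf : f.IsHomogeneous a) (g : MvPolynomial (Fin n) K) {m : ℕ} (h : a ≤ m) :
    homogeneousComponent m (f * g) = f * homogeneousComponent (m - a) g := by
  have := DirectSum.coe_decompose_mul_of_left_mem_of_le (homogeneousSubmodule (Fin n) K)
    (b := g) (mem_homogeneousSubmodule a f |>.2 hf) h
  rwa [← decomposition.decompose'_apply, ← decomposition.decompose'_apply]

attribute [local instance] MvPolynomial.gradedAlgebra in
theorem homogeneousComponent_mul_of_not_le {f : MvPolynomial (Fin n) K} {a : ℕ}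
    (hf : f.IsHomogeneous a) (g : MvPolynomial (Fin n) K) {m : ℕ} (h : ¬ a ≤ m) :
    homogeneousComponent m (f * g) = 0 := by
  have := DirectSum.coe_decompose_mul_of_left_mem_of_not_le (homogeneousSubmodule (Fin n) K)
    (b := g) (mem_homogeneousSubmodule a f |>.2 hf) h
  rwa [← decomposition.decompose'_apply]

theorem degreeProj_mul {f : MvPolynomial (Fin n) K} {a : ℕ} (hf : f.IsHomogeneous a)
    (g : MvPolynomial (Fin n) K) (u : ℤ) :
    degreeProj K n u (f * g) = f * degreeProj K n (u - a) g := by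
  unfold degreeProj
  by_cases h : 0 ≤ u - a
  · rw [if_pos (show 0 ≤ u by omega), if_pos h, homogeneousComponent_mul_of_le hf g (by omega)]
    congr 3
    omega
  · rw [if_neg h]
    split_ifs with h'
    · rw [homogeneousComponent_mul_of_not_le hf g (by omega)]
      simp
    · simp

variable (K n)

theorem finrank_homogeneousSubmodule (t : ℕ) :
    Module.finrank K (homogeneousSubmodule (Fin n) K t) = n.multichoose t := by
  rw [homogeneousSubmodule_eq_finsupp_supported]
  change Module.finrank K (restrictSupport K {d : Fin n →₀ ℕ | d.degree = t}) = _
  rw [Module.finrank_eq_nat_card_basis (basisRestrictSupport K _)]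
  have : {d : Fin n →₀ ℕ | d.degree = t} =
      ((Finset.univ : Finset (Fin n)).finsuppAntidiag t) := by
    ext d
    simp [Finsupp.degree_eq_sum]
  rw [this, SetLike.coe_sort_coe, Nat.card_eq_fintype_card, Fintype.card_coe,
    Finset.card_finsuppAntidiag_nat_eq_multichoose, Finset.card_univ, Fintype.card_fin]

instance (t : ℕ) : Module.Finite K (homogeneousSubmodule (Fin n) K t) :=
  Module.Finite.iff_fg.2 (homogeneousSubmodule_fg _ _ t)

instance (u : ℤ) : Module.Finite K (degreePart K n u) := by
  by_cases h : 0 ≤ u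
  · rw [degreePart, if_pos h]
    infer_instance
  · rw [degreePart, if_neg h]
    infer_instance

theorem one_sub_pow_mul_mk_multichoose (n : ℕ) :
    (1 - PowerSeries.X) ^ n * PowerSeries.mk (fun t => (n.multichoose t : ℤ)) = 1 := by
  have h : PowerSeries.mk (fun t => (n.multichoose t : ℤ)) = PowerSeries.invOneSubPow ℤ n := by
    cases n with
    | zero =>
      rw [PowerSeries.invOneSubPow_zero]
      ext t
      cases t <;> simp [PowerSeries.coeff_one]
    | succ n =>
      rw [PowerSeries.invOneSubPow_val_succ_eq_mk_add_choose]
      ext t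
      rw [PowerSeries.coeff_mk, PowerSeries.coeff_mk, Nat.multichoose_eq]
      congr 1
      rw [show n + 1 + t - 1 = n + t by omega, ← Nat.choose_symm_add, Nat.add_comm]
  rw [h, ← PowerSeries.invOneSubPow_inv_eq_one_sub_pow]
  exact (PowerSeries.invOneSubPow ℤ n).inv_val

theorem mk_finrank_degreePart (a : ℕ) :
    PowerSeries.mk (fun t : ℕ => (Module.finrank K (degreePart K n (t - a)) : ℤ)) =
      PowerSeries.X ^ a * PowerSeries.mk (fun t => (n.multichoose t : ℤ)) := by
  ext t
  rw [PowerSeries.coeff_mk, PowerSeries.coeff_X_pow_mul']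
  split_ifs with h
  · rw [PowerSeries.coeff_mk, degreePart, if_pos (by omega), finrank_homogeneousSubmodule,
      show ((t : ℤ) - a).toNat = t - a by omega]
  · rw [degreePart, if_neg (by omega)]
    simp

variable {n}

/-- The component of degree `t` of `⨁ R(-a i)`. -/
noncomputable def freePart {m : ℕ} (a : Fin m → ℤ) (t : ℤ) :
    Submodule K (Fin m → MvPolynomial (Fin n) K) :=
  Submodule.pi Set.univ fun i => degreePart K n (t - a i)

variable {K} in
theorem mem_freePart {m : ℕ} {a : Fin m → ℤ} {t : ℤ} {v : Fin m → MvPolynomial (Fin n) K} :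
    v ∈ freePart K a t ↔ ∀ i, v i ∈ degreePart K n (t - a i) := by
  simp [freePart, Submodule.mem_pi]

/-- `freePart` as a product. -/
noncomputable def freePartEquiv {m : ℕ} (a : Fin m → ℤ) (t : ℤ) :
    freePart (n := n) K a t ≃ₗ[K] ∀ i, degreePart K n (t - a i) where
  toFun v i := ⟨v.1 i, mem_freePart.1 v.2 i⟩
  invFun v := ⟨fun i => v i, mem_freePart.2 fun i => (v i).2⟩
  map_add' _ _ := rfl
  map_smul' _ _ := rfl
  left_inv _ := rfl
  right_inv _ := rfl

instance {m : ℕ} (a : Fin m → ℤ) (t : ℤ) : Module.Finite K (freePart (n := n) K a t) :=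
  Module.Finite.equiv (freePartEquiv K a t).symm

theorem finrank_freePart {m : ℕ} (a : Fin m → ℤ) (t : ℤ) :
    Module.finrank K (freePart (n := n) K a t) =
      ∑ i, Module.finrank K (degreePart K n (t - a i)) := by
  rw [(freePartEquiv K a t).finrank_eq, Module.finrank_pi_fintype]

variable {K}

theorem finrank_map_add_finrank_inf_ker {V W : Type*} [AddCommGroup V] [Module K V]
    [AddCommGroup W] [Module K W] (f : V →ₗ[K] W) (S : Submodule K V) [Module.Finite K S] :
    Module.finrank K (S.map f) + Module.finrank K (S ⊓ LinearMap.ker f : Submodule K V) =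
      Module.finrank K S := by
  rw [← LinearMap.finrank_range_add_finrank_ker (f.domRestrict S), LinearMap.range_domRestrict,
    LinearMap.ker_domRestrict, ← (Submodule.equivSubtypeMap S _).finrank_eq.symm,
    Submodule.map_comap_subtype]

end DegreeParts

namespace MinimalGradedFreeResolution

variable {K : Type*} [Field K] {n : ℕ} {I : Ideal (MvPolynomial (Fin n) K)}
  (F : MinimalGradedFreeResolution I)

/-- The differentials of `F` as `K`-linear maps. -/
noncomputable def diff (i : ℕ) : (Fin (F.rank (i + 1)) → MvPolynomial (Fin n) K) →ₗ[K]
    (Fin (F.rank i) → MvPolynomial (Fin n) K) :=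
  (F.d i).mulVecLin.restrictScalars K

theorem diff_apply (i : ℕ) (v) (j) : F.diff i v j = ∑ k, F.d i j k * v k := rfl

theorem degreeProj_d_mul (i : ℕ) (j k) (g : MvPolynomial (Fin n) K) (t : ℤ) :
    degreeProj K n (t - F.shift i j) (F.d i j k * g) =
      F.d i j k * degreeProj K n (t - F.shift (i + 1) k) g := by
  by_cases h : F.d i j k = 0
  · simp [h]
  · obtain ⟨a, ha, hh⟩ := F.homogeneous i j k h
    rw [degreeProj_mul hh, ← ha]
    congr 2
    abel_nf

/-- Homogeneity lets a preimage be replaced by its degree-`t` part, so exactness passes to each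
graded strand. -/
theorem map_diff_freePart (i : ℕ) (t : ℤ) :
    (freePart K (F.shift (i + 1)) t).map (F.diff i) =
      freePart K (F.shift i) t ⊓ LinearMap.range (F.diff i) := by
  have key : ∀ w j, F.diff i (fun k => degreeProj K n (t - F.shift (i + 1) k) (w k)) j =
      degreeProj K n (t - F.shift i j) (F.diff i w j) := by
    intro w j
    rw [diff_apply, diff_apply, map_sum]
    exact Finset.sum_congr rfl fun k _ => (F.degreeProj_d_mul i j k _ t).symm
  ext v
  constructor
  · rintro ⟨w, hw, rfl⟩
    refine ⟨mem_freePart.2 fun j => ?_, w, rfl⟩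
    have hw' : (fun k => degreeProj K n (t - F.shift (i + 1) k) (w k)) = w :=
      funext fun k => degreeProj_of_mem (mem_freePart.1 hw k)
    rw [← hw', key]
    exact degreeProj_mem _ _ _ _
  · rintro ⟨hv, w, rfl⟩
    refine ⟨_, mem_freePart.2 fun k => degreeProj_mem K n (t - F.shift (i + 1) k) (w k), ?_⟩
    funext j
    rw [key, degreeProj_of_mem (mem_freePart.1 hv j)]

theorem ker_diff (i : ℕ) : LinearMap.ker (F.diff i) = LinearMap.range (F.diff (i + 1)) := by
  ext v
  exact F.exact i v

/-- The augmentation `F₀ → R/I`. -/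
noncomputable def augmentation :
    (Fin (F.rank 0) → MvPolynomial (Fin n) K) →ₗ[K] MvPolynomial (Fin n) K ⧸ I :=
  (Ideal.Quotient.mkₐ K I).toLinearMap.comp (LinearMap.proj F.zeroIndex)

theorem ker_augmentation : LinearMap.ker F.augmentation = LinearMap.range (F.diff 0) := by
  ext v
  have h : v ∈ LinearMap.ker F.augmentation ↔ v F.zeroIndex ∈ I := Ideal.Quotient.eq_zero_iff_mem
  rw [h, F.mem_iff_exists_mulVecLin]
  exact exists_congr fun w => ⟨fun hw => funext fun j => by rw [F.eq_zeroIndex j, ← hw]; rfl,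
    fun hw => congrFun hw _⟩

theorem map_augmentation_freePart (t : ℕ) :
    (freePart K (F.shift 0) t).map F.augmentation = component I t := by
  rw [augmentation, Submodule.map_comp, component]
  congr 1
  ext f
  constructor
  · rintro ⟨v, hv, rfl⟩
    have := mem_freePart.1 hv F.zeroIndex
    rw [F.shift_zero, sub_zero, degreePart, if_pos (by omega), Int.toNat_natCast] at this
    exact this
  · intro hf
    refine ⟨fun _ => f, mem_freePart.2 fun j => ?_, rfl⟩
    rw [F.shift_zero, sub_zero, degreePart, if_pos (by omega), Int.toNat_natCast]
    exact hf

/-- Dimension count along the degree-`t` strand of 0 → F₂ → F₁ → F₀ → R/I → 0. The cast zero matches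
the form of `mk_finrank_degreePart`. -/
theorem finrank_component (h3 : F.rank 3 = 0) (t : ℕ) :
    (Module.finrank K (component I t) : ℤ) = Module.finrank K (degreePart K n (t - (0 : ℕ))) -
      ∑ i, (Module.finrank K (degreePart K n (t - F.shift 1 i)) : ℤ) +
      ∑ k, (Module.finrank K (degreePart K n (t - F.shift 2 k)) : ℤ) := by
  have h0 := finrank_map_add_finrank_inf_ker F.augmentation (freePart K (F.shift 0) t)
  have h1 := finrank_map_add_finrank_inf_ker (F.diff 0) (freePart K (F.shift 1) t)
  have h2 := finrank_map_add_finrank_inf_ker (F.diff 1) (freePart K (F.shift 2) t)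
  rw [map_augmentation_freePart, ker_augmentation, ← map_diff_freePart] at h0
  rw [ker_diff, ← map_diff_freePart] at h1
  have hker : LinearMap.ker (F.diff 1) = ⊥ :=
    LinearMap.ker_eq_bot.2 (F.mulVecLin_one_injective h3)
  rw [hker, inf_bot_eq, finrank_bot, add_zero] at h2
  rw [finrank_freePart] at h0 h1 h2
  rw [Finset.sum_eq_single F.zeroIndex (fun j _ hj => absurd (F.eq_zeroIndex j) hj)
    (fun h => absurd (Finset.mem_univ _) h), F.shift_zero] at h0
  push_cast at *
  linarith

/-- The numerator of the Hilbert series of `R/I` over `(1 - X) ^ n`. -/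
noncomputable def numerator : Polynomial ℤ :=
  1 - ∑ i, Polynomial.X ^ (F.shift 1 i).toNat + ∑ k, Polynomial.X ^ (F.shift 2 k).toNat

theorem one_sub_pow_mul_hilbertSeries (h3 : F.rank 3 = 0) :
    (1 - PowerSeries.X) ^ n * hilbertSeries I = (F.numerator : PowerSeries ℤ) := by
  have hH : hilbertSeries I =
      (F.numerator : PowerSeries ℤ) * PowerSeries.mk (fun t => (n.multichoose t : ℤ)) := by
    have h1 : ∀ i t, Module.finrank K (degreePart K n (t - F.shift 1 i)) =
        Module.finrank K (degreePart K n (t - ((F.shift 1 i).toNat : ℕ))) := fun i t => by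
      rw [Int.toNat_of_nonneg (F.shift_one_pos i).le]
    have h2 : ∀ k t, Module.finrank K (degreePart K n (t - F.shift 2 k)) =
        Module.finrank K (degreePart K n (t - ((F.shift 2 k).toNat : ℕ))) := fun k t => by
      rw [Int.toNat_of_nonneg (F.shift_two_pos h3 k).le]
    have hnum : (F.numerator : PowerSeries ℤ) = PowerSeries.X ^ 0
        - ∑ i, PowerSeries.X ^ (F.shift 1 i).toNat + ∑ k, PowerSeries.X ^ (F.shift 2 k).toNat := by
      have hs : ∀ {m : ℕ} (a : Fin m → ℕ), ((∑ i, Polynomial.X ^ a i : Polynomial ℤ) :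
          PowerSeries ℤ) = ∑ i, PowerSeries.X ^ a i := fun a => by
        rw [← Polynomial.coeToPowerSeries.ringHom_apply, map_sum]
        simp
      rw [numerator, Polynomial.coe_add, Polynomial.coe_sub, hs, hs, Polynomial.coe_one, pow_zero]
    rw [hnum, add_mul, sub_mul, Finset.sum_mul, Finset.sum_mul]
    simp only [← mk_finrank_degreePart K n]
    ext t
    rw [map_add, map_sub, map_sum, map_sum]
    simp only [hilbertSeries, PowerSeries.coeff_mk]
    rw [F.finrank_component h3]
    simp only [h1, h2]
  rw [hH, mul_left_comm, one_sub_pow_mul_mk_multichoose, mul_one]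

end MinimalGradedFreeResolution

end GradedAlgebraBounds

/-! ### Krull dimension bounds the growth of the Hilbert function. -/

namespace GradedAlgebraBounds

open MvPolynomial

/-- Lying over and going up lift a chain of primes of `A` to one of the same length in `B`. -/
theorem ringKrullDim_le_of_isIntegral_of_injective {A B : Type*} [CommRing A] [CommRing B]
    (f : A →+* B) (hf : f.IsIntegral) (h : Function.Injective f) :
    ringKrullDim A ≤ ringKrullDim B := by
  algebraize [f]
  refine iSup_le fun l => ?_
  obtain ⟨Q, -, hQ, hQl⟩ := Ideal.exists_ideal_over_prime_of_isIntegral l.head.asIdeal (⊥ : Ideal B)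
    (by
      change RingHom.ker f ≤ _
      rw [(RingHom.injective_iff_ker_eq_bot _).1 h]
      exact bot_le)
  have : Q.LiesOver l.head.asIdeal := ⟨hQl.symm⟩
  obtain ⟨L, hL, -, -⟩ := Ideal.exists_ltSeries_of_hasGoingUp (S := B) l Q
  rw [← hL]
  exact le_iSup (fun l : LTSeries (PrimeSpectrum B) => ((l.length : ℕ∞) : WithBot ℕ∞)) L

section Growth

variable {K : Type*} [Field K]

theorem finrank_restrictDegree_le (s N : ℕ) :
    Module.finrank K (restrictDegree (Fin s) K N) ≤ (N + 1) ^ s := by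
  rw [restrictDegree, Module.finrank_eq_nat_card_basis (basisRestrictSupport K _)]
  have h : Function.Injective (fun (f : {f : Fin s →₀ ℕ | ∀ i, f i ≤ N}) (i : Fin s) =>
      (⟨f.1 i, Nat.lt_succ_of_le (f.2 i)⟩ : Fin (N + 1))) := by
    intro f g hfg
    ext i
    exact Fin.mk.inj (congrFun hfg i)
  simpa using Nat.card_le_card_of_injective _ h

theorem restrictDegree_mono {s M N : ℕ} (h : M ≤ N) :
    restrictDegree (Fin s) K M ≤ restrictDegree (Fin s) K N := fun p hp => by
  rw [mem_restrictDegree] at hp ⊢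
  exact fun d hd i => (hp d hd i).trans h

theorem mul_mem_restrictDegree {s M N : ℕ} {p q : MvPolynomial (Fin s) K}
    (hp : p ∈ restrictDegree (Fin s) K M) (hq : q ∈ restrictDegree (Fin s) K N) :
    p * q ∈ restrictDegree (Fin s) K (M + N) := by
  classical
  rw [mem_restrictDegree] at hp hq ⊢
  intro d hd i
  obtain ⟨a, ha, b, hb, rfl⟩ := Finset.mem_add.1 (support_mul p q hd)
  exact add_le_add (hp a ha i) (hq b hb i)

theorem exists_mem_restrictDegree {ι : Type*} [Finite ι] {s : ℕ}
    (p : ι → MvPolynomial (Fin s) K) : ∃ D, ∀ i, p i ∈ restrictDegree (Fin s) K D := by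
  cases nonempty_fintype ι
  refine ⟨Finset.univ.sup fun i => (p i).totalDegree, fun i => ?_⟩
  refine restrictDegree_mono (Finset.le_sup (f := fun i => (p i).totalDegree) (Finset.mem_univ i))
    (restrictTotalDegree_le_restrictDegree _ _ _ ?_)
  rw [mem_restrictTotalDegree]

/-- In an algebra that is finite over a polynomial ring in `s` variables, the polynomials of degree
`≤ t` in given elements span a space whose dimension grows at most like `t ^ s`. -/
theorem exists_growth_bound {A : Type*} [CommRing A] [Algebra K A] {s n : ℕ}
    (g : MvPolynomial (Fin s) K →ₐ[K] A) (hg : g.Finite) (x : Fin n → A) :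
    ∃ C D : ℕ, ∀ t : ℕ, ∃ W : Submodule K A, Module.Finite K W ∧
      Module.finrank K W ≤ C * (D * (t + 1) + 1) ^ s ∧
      ∀ f : MvPolynomial (Fin n) K, f.totalDegree ≤ t → aeval x f ∈ W := by
  algebraize [g.toRingHom]
  have hfin : Module.Finite (MvPolynomial (Fin s) K) A := hg
  obtain ⟨r, a, ha⟩ := Module.Finite.exists_fin (R := MvPolynomial (Fin s) K) (M := A)
  let L : (Fin r → MvPolynomial (Fin s) K) →ₗ[K] A :=
    ∑ j, (LinearMap.mulRight K (a j)).comp (g.toLinearMap.comp (LinearMap.proj j))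
  have hL : ∀ p, L p = ∑ j, g (p j) * a j := fun p => by simp [L]
  have hsurj : ∀ b, ∃ p, L p = b := by
    intro b
    have hb : b ∈ Submodule.span (MvPolynomial (Fin s) K) (Set.range a) := ha ▸ trivial
    obtain ⟨c, hc⟩ := (Submodule.mem_span_range_iff_exists_fun _).1 hb
    exact ⟨c, by rw [hL, ← hc]; exact Finset.sum_congr rfl fun j _ => (Algebra.smul_def _ _).symm⟩
  choose u hu using hsurj
  -- `D` bounds the degrees of the chosen coefficients of `1` (`none`) and of the products `x i * a
  -- j` (`some`), so each multiplication by some `x i` costs at most `D`.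
  obtain ⟨D, hD⟩ := exists_mem_restrictDegree
    (fun o : Option (Fin n × Fin r) × Fin r => u (o.1.elim 1 fun ij => x ij.1 * a ij.2) o.2)
  have hD1 : ∀ k, u 1 k ∈ restrictDegree (Fin s) K D := fun k => hD (none, k)
  have hDx : ∀ i j k, u (x i * a j) k ∈ restrictDegree (Fin s) K D :=
    fun i j k => hD (some (i, j), k)
  let V : ℕ → Submodule K (Fin r → MvPolynomial (Fin s) K) := fun t =>
    Submodule.pi Set.univ fun _ => restrictDegree (Fin s) K (D * (t + 1))
  have hV : ∀ t p, p ∈ V t ↔ ∀ j, p j ∈ restrictDegree (Fin s) K (D * (t + 1)) := fun t p => by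
    simp [V, Submodule.mem_pi]
  let e : ∀ t, V t ≃ₗ[K] (Fin r → restrictDegree (Fin s) K (D * (t + 1))) := fun t =>
    { toFun := fun v j => ⟨v.1 j, (hV t _).1 v.2 j⟩
      invFun := fun v => ⟨fun j => v j, (hV t _).2 fun j => (v j).2⟩
      map_add' := fun _ _ => rfl
      map_smul' := fun _ _ => rfl
      left_inv := fun _ => rfl
      right_inv := fun _ => rfl }
  have hVfin : ∀ t, Module.Finite K (V t) := fun t => Module.Finite.equiv (e t).symm
  refine ⟨r, D, fun t => ⟨(V t).map L, inferInstance, ?_, ?_⟩⟩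
  · refine (Submodule.finrank_map_le _ _).trans ?_
    rw [(e t).finrank_eq, Module.finrank_pi_fintype, Finset.sum_const, Finset.card_univ,
      Fintype.card_fin, smul_eq_mul]
    exact Nat.mul_le_mul_left _ (finrank_restrictDegree_le _ _)
  · have hone : ∀ t, (1 : A) ∈ (V t).map L := fun t =>
      ⟨u 1, (hV t _).2 fun k => restrictDegree_mono (by nlinarith) (hD1 k), hu 1⟩
    have hmul : ∀ t i, ∀ w ∈ (V t).map L, x i * w ∈ (V (t + 1)).map L := by
      rintro t i _ ⟨p, hp, rfl⟩
      refine ⟨fun k => ∑ j, p j * u (x i * a j) k, (hV _ _).2 fun k =>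
        Submodule.sum_mem _ fun j _ => ?_, ?_⟩
      · rw [mul_add_one D (t + 1)]
        exact mul_mem_restrictDegree ((hV t p).1 hp j) (hDx i j k)
      · rw [hL, hL, Finset.mul_sum]
        simp only [map_sum, map_mul, Finset.sum_mul]
        rw [Finset.sum_comm]
        refine Finset.sum_congr rfl fun j _ => ?_
        have h1 := (hL _).symm.trans (hu (x i * a j))
        rw [mul_left_comm, ← h1, Finset.mul_sum]
        exact Finset.sum_congr rfl fun k _ => by rw [h1, mul_assoc]
    have hmon : ∀ t, ∀ d : Fin n →₀ ℕ, d.degree ≤ t →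
        aeval x (monomial d (1 : K)) ∈ (V t).map L := by
      intro t
      induction t with
      | zero =>
        intro d hd
        have : d = 0 := (Finsupp.degree_eq_zero_iff d).1 (Nat.le_zero.1 hd)
        simpa [this] using hone 0
      | succ t ih =>
        intro d hd
        by_cases h : d = 0
        · simpa [h] using hone (t + 1)
        · obtain ⟨i, hi⟩ := Finsupp.ne_iff.1 h
          have hle : Finsupp.single i 1 ≤ d := by
            rw [Finsupp.single_le_iff]
            exact Nat.one_le_iff_ne_zero.2 hi
          obtain ⟨d', rfl⟩ := le_iff_exists_add.1 hle
          have h2 : (monomial (Finsupp.single i 1 + d') (1 : K)) = X i * monomial d' 1 := by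
            rw [X, monomial_mul, one_mul]
          rw [h2, map_mul, aeval_X]
          refine hmul t i _ (ih d' ?_)
          rw [map_add, Finsupp.degree_single] at hd
          omega
    intro f hf
    rw [f.as_sum, map_sum]
    refine Submodule.sum_mem _ fun d hd => ?_
    have h3 : monomial d (coeff d f) = coeff d f • monomial d (1 : K) := by
      rw [smul_monomial, smul_eq_mul, mul_one]
    rw [h3, map_smul]
    exact Submodule.smul_mem _ _ (hmon t d ((le_totalDegree hd).trans hf))

variable {n : ℕ} {I : Ideal (MvPolynomial (Fin n) K)}

instance (t : ℕ) : Module.Finite K (component I t) := by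
  unfold component
  infer_instance

/-- The projection of `R/I` to its component of degree `t`, for a graded ideal `I`. -/
noncomputable def componentProj (hI : IsGraded I) (t : ℕ) :
    (MvPolynomial (Fin n) K ⧸ I) →ₗ[K] MvPolynomial (Fin n) K ⧸ I :=
  (Submodule.liftQ (I.restrictScalars K)
    ((Ideal.Quotient.mkₐ K I).toLinearMap.comp (homogeneousComponent t)) (fun _ hf =>
      Ideal.Quotient.eq_zero_iff_mem.2 (homogeneousComponent_mem_of_mem hI hf t))).comp
    (Submodule.Quotient.restrictScalarsEquiv K I).symm.toLinearMap

theorem componentProj_mk (hI : IsGraded I) (t : ℕ) (f : MvPolynomial (Fin n) K) :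
    componentProj hI t (Ideal.Quotient.mk I f) =
      Ideal.Quotient.mk I (homogeneousComponent t f) := rfl

theorem componentProj_mem (hI : IsGraded I) (t : ℕ) (v) : componentProj hI t v ∈ component I t := by
  obtain ⟨f, rfl⟩ := Ideal.Quotient.mk_surjective v
  exact ⟨homogeneousComponent t f, homogeneousComponent_mem _ _, rfl⟩

/-- `W` surjects onto the product of the components of degree at most `t`. -/
theorem sum_finrank_component_le (hI : IsGraded I) (t : ℕ)
    (W : Submodule K (MvPolynomial (Fin n) K ⧸ I)) [Module.Finite K W]
    (hW : ∀ f : MvPolynomial (Fin n) K, f.totalDegree ≤ t → Ideal.Quotient.mk I f ∈ W) :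
    ∑ s ∈ Finset.range (t + 1), Module.finrank K (component I s) ≤ Module.finrank K W := by
  rw [Finset.sum_range, ← Module.finrank_pi_fintype K]
  let Φ : W →ₗ[K] ∀ s : Fin (t + 1), component I s := LinearMap.pi fun s =>
    ((componentProj hI s).comp W.subtype).codRestrict _ fun w => componentProj_mem hI s w
  refine LinearMap.finrank_le_finrank_of_surjective (f := Φ) fun v => ?_
  have hv : ∀ s, ∃ f, f.IsHomogeneous s ∧ Ideal.Quotient.mk I f = (v s : _) := fun s => (v s).2
  choose f hf hfv using hv
  refine ⟨⟨Ideal.Quotient.mk I (∑ s, f s), hW _ ?_⟩, ?_⟩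
  · exact totalDegree_finsetSum_le fun s _ => (hf s).totalDegree_le.trans (by omega)
  · funext s
    apply Subtype.ext
    change componentProj hI s (Ideal.Quotient.mk I (∑ s, f s)) = _
    rw [componentProj_mk, ← hfv, map_sum]
    congr 1
    rw [Finset.sum_eq_single s]
    · rw [homogeneousComponent_of_mem (hf s), if_pos rfl]
    · intro s' _ hs
      rw [homogeneousComponent_of_mem (hf s'), if_neg (fun h => hs (Fin.ext h.symm))]
    · exact fun h => absurd (Finset.mem_univ s) h

/-- The cumulative Hilbert function of `R/I` grows at most like `t ^ dim R/I`. -/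
theorem exists_sum_finrank_component_le (hI : IsGraded I) {d : ℕ}
    (hd : ringKrullDim (MvPolynomial (Fin n) K ⧸ I) = d) :
    ∃ C D : ℕ, ∀ t : ℕ, ∑ s ∈ Finset.range (t + 1), Module.finrank K (component I s) ≤
      C * (D * (t + 1) + 1) ^ d := by
  have hnt : Nontrivial (MvPolynomial (Fin n) K ⧸ I) := by
    by_contra h
    rw [not_nontrivial_iff_subsingleton] at h
    rw [ringKrullDim_eq_bot_of_subsingleton] at hd
    exact absurd hd.symm (WithBot.coe_ne_bot)
  -- Noether normalization: injectivity gives `s ≤ d`, finiteness gives growth of order at most `s`.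
  obtain ⟨s, g, hg, hfin⟩ := exists_finite_inj_algHom_of_fg K (MvPolynomial (Fin n) K ⧸ I)
  have hs : s ≤ d := by
    have := ringKrullDim_le_of_isIntegral_of_injective g.toRingHom hfin.to_isIntegral hg
    rw [MvPolynomial.ringKrullDim_of_isNoetherianRing, ringKrullDim_eq_zero_of_field, hd, zero_add,
      Nat.card_eq_fintype_card, Fintype.card_fin] at this
    exact_mod_cast this
  obtain ⟨C, D, h⟩ := exists_growth_bound g hfin (fun i => Ideal.Quotient.mk I (X i))
  refine ⟨C, D, fun t => ?_⟩
  obtain ⟨W, hW, hWC, hWf⟩ := h t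
  refine (sum_finrank_component_le hI t W fun f hf => ?_).trans (hWC.trans ?_)
  · have := hWf f hf
    rwa [show aeval (fun i => Ideal.Quotient.mk I (X i)) f = Ideal.Quotient.mk I f from
      (DFunLike.congr_fun (MvPolynomial.mkₐ_eq_aeval (I := I)) f).symm] at this
  · exact Nat.mul_le_mul_left _ (Nat.pow_le_pow_right (Nat.succ_pos _) hs)

end Growth

end GradedAlgebraBounds

/-! ### Numerical constraints on the shifts, and the bounds. -/

namespace GradedAlgebraBounds

/-- One more factor 1/(1-z) turns `h` into its partial sums. For `P ≠ 0` these eventually agree with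
a polynomial which, if 1 is a root of multiplicity less than 2, has degree at least `d + 1`; yet
they lie between 0 and a polynomial of degree at most `d`. -/
theorem one_sub_X_sq_dvd_of_growth {P : Polynomial ℤ} {h : ℕ → ℕ} {d C D : ℕ}
    (hP : (1 - PowerSeries.X) ^ (d + 2) * PowerSeries.mk (fun t => (h t : ℤ)) =
      (P : PowerSeries ℤ))
    (hh : ∀ t, ∑ s ∈ Finset.range (t + 1), h s ≤ C * (D * (t + 1) + 1) ^ d) :
    (1 - Polynomial.X) ^ 2 ∣ P := by
  set p : Polynomial ℚ := P.map (Int.castRingHom ℚ) with hp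
  have hpP : (1 - PowerSeries.X) ^ (d + 2) * PowerSeries.mk (fun t => (h t : ℚ)) =
      (p : PowerSeries ℚ) := by
    have := congrArg (PowerSeries.map (Int.castRingHom ℚ)) hP
    rw [map_mul, map_pow, map_sub, map_one, PowerSeries.map_X] at this
    have hc : PowerSeries.map (Int.castRingHom ℚ) (P : PowerSeries ℤ) = (p : PowerSeries ℚ) := by
      ext t
      simp [hp]
    rw [← hc, ← this]
    congr 1
  have hsum : ∀ t, PowerSeries.coeff t (p * PowerSeries.invOneSubPow ℚ (1 + (d + 2)) :
      PowerSeries ℚ) = ∑ s ∈ Finset.range (t + 1), (h s : ℚ) := by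
    intro t
    rw [← hpP, mul_right_comm,
      PowerSeries.one_sub_pow_mul_invOneSubPow_val_add_eq_invOneSubPow_val, mul_comm,
      ← zero_add 1, PowerSeries.invOneSubPow_val_succ_eq_mk_add_choose, PowerSeries.coeff_mul,
      Finset.Nat.sum_antidiagonal_eq_sum_range_succ_mk]
    simp
  suffices hdvd : (Polynomial.X - Polynomial.C 1) ^ 2 ∣ p by
    have hmap : (((Polynomial.X - Polynomial.C 1) ^ 2 : Polynomial ℤ)).map (Int.castRingHom ℚ) ∣
        P.map (Int.castRingHom ℚ) := by simpa using hdvd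
    rw [Polynomial.map_dvd_map _ Int.cast_injective ((Polynomial.monic_X_sub_C 1).pow 2)] at hmap
    rwa [← neg_sub, neg_sq]
  by_cases hp0 : p = 0
  · simp [hp0]
  rw [← Polynomial.le_rootMultiplicity_iff hp0]
  by_contra! hlt
  set q := Polynomial.hilbertPoly p (1 + (d + 2)) with hq
  have hdeg : d + 1 ≤ q.natDegree := by
    rw [hq, Polynomial.natDegree_hilbertPoly_of_ne_zero_of_rootMultiplicity_lt hp0 (by omega)]
    omega
  have hqt : ∀ t : ℕ, p.natDegree < t → q.eval (t : ℚ) = ∑ s ∈ Finset.range (t + 1), (h s : ℚ) :=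
    fun t ht => by
      rw [hq, ← Polynomial.coeff_mul_invOneSubPow_eq_hilbertPoly_eval _ ht, hsum]
  set B : Polynomial ℚ :=
    Polynomial.C (C : ℚ) * (Polynomial.C (D : ℚ) * (Polynomial.X + 1) + 1) ^ d with hB
  have hBdeg : B.natDegree ≤ d := by
    have h1 : (Polynomial.C (D : ℚ) * (Polynomial.X + 1) + 1).natDegree ≤ 1 := by compute_degree
    refine (Polynomial.natDegree_C_mul_le _ _).trans (Polynomial.natDegree_pow_le.trans ?_)
    simpa using Nat.mul_le_mul_left d h1
  have hBt : ∀ t : ℕ, p.natDegree < t → 0 ≤ (B - q).eval (t : ℚ) := fun t ht => by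
    rw [Polynomial.eval_sub, hqt t ht, sub_nonneg, hB]
    simp only [Polynomial.eval_mul, Polynomial.eval_C, Polynomial.eval_pow, Polynomial.eval_add,
      Polynomial.eval_X, Polynomial.eval_one]
    exact_mod_cast hh t
  have hlt' : B.degree < q.degree :=
    Polynomial.degree_lt_degree (by omega)
  have hnot : ∀ r : Polynomial ℚ, 0 < r.degree → r.leadingCoeff ≤ 0 →
      (∀ t : ℕ, p.natDegree < t → 0 ≤ r.eval (t : ℚ)) → False := by
    intro r hr hr' hrt
    have h1 := (r.tendsto_atBot_of_leadingCoeff_nonpos hr hr').comp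
      (tendsto_natCast_atTop_atTop (R := ℚ))
    obtain ⟨t, ht, ht'⟩ := ((h1.eventually (Filter.eventually_lt_atBot 0)).and
      (Filter.eventually_gt_atTop p.natDegree)).exists
    exact absurd ht (not_lt.2 (hrt t ht'))
  have hqpos : 0 < q.degree := Polynomial.natDegree_pos_iff_degree_pos.1 (by omega)
  -- The sign of the leading coefficient decides which bound fails, the lower bound 0 or the upper
  -- bound `B`.
  rcases le_total q.leadingCoeff 0 with hc | hc
  · exact hnot q hqpos hc fun t ht => by rw [hqt t ht]; positivity
  · have h1 : (B - q).degree = q.degree := Polynomial.degree_sub_eq_right_of_degree_lt hlt'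
    refine hnot (B - q) (by rwa [h1]) ?_ hBt
    rw [Polynomial.leadingCoeff_sub_of_degree_lt' hlt']
    exact neg_nonpos.2 hc

theorem sum_sq_sub_sum_sq_bounds {l : ℕ} {a : Fin (l + 2) → ℤ} {b : Fin (l + 1) → ℤ}
    (ha : Monotone a) (hb : Monotone b) (hab : ∀ k, a k.succ ≤ b k) (hsum : ∑ i, a i = ∑ k, b k) :
    a 0 * b 0 + (b (Fin.last l) - a (Fin.last (l + 1))) *
        (b (Fin.last l) - b 0 + a (Fin.last (l + 1)) - a 0) ≤
      ∑ k, b k ^ 2 - ∑ i, a i ^ 2 ∧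
    ∑ k, b k ^ 2 - ∑ i, a i ^ 2 ≤ a (Fin.last (l + 1)) * b (Fin.last l) -
      (b 0 - a 0) * (b (Fin.last l) - b 0 + a (Fin.last (l + 1)) - a 0) := by
  constructor
  · rw [Fin.sum_univ_succ a] at hsum
    rw [Fin.sum_univ_succ (fun i => a i ^ 2)]
    -- Because the differences have a known sum, subtracting `a 0 + b 0` from each factor `b k + a
    -- k.succ` has a known effect and makes every summand nonnegative.
    have hc : ∑ k, (b k - a k.succ) = a 0 := by
      rw [Finset.sum_sub_distrib]
      linarith
    have h1 : (b (Fin.last l) - a (Fin.last l).succ) *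
        (b (Fin.last l) + a (Fin.last l).succ - (a 0 + b 0)) ≤
        ∑ k, (b k - a k.succ) * (b k + a k.succ - (a 0 + b 0)) :=
      Finset.single_le_sum (f := fun k => (b k - a k.succ) * (b k + a k.succ - (a 0 + b 0)))
        (fun k _ => mul_nonneg (sub_nonneg.2 (hab k)) (by
          have := ha (Fin.zero_le k.succ)
          have := hb (Fin.zero_le k)
          linarith)) (Finset.mem_univ _)
    have h2 : ∑ k, (b k - a k.succ) * (b k + a k.succ - (a 0 + b 0)) =
        ∑ k, b k ^ 2 - ∑ k : Fin (l + 1), a k.succ ^ 2 - a 0 * (a 0 + b 0) := by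
      rw [← hc, Finset.sum_mul, ← Finset.sum_sub_distrib, ← Finset.sum_sub_distrib, hc]
      exact Finset.sum_congr rfl fun k _ => by ring
    rw [Fin.succ_last] at h1
    linarith
  · rw [Fin.sum_univ_castSucc a] at hsum
    rw [Fin.sum_univ_castSucc (fun i => a i ^ 2)]
    have hc : ∑ k, (b k - a k.castSucc) = a (Fin.last (l + 1)) := by
      rw [Finset.sum_sub_distrib]
      linarith
    have h1 : (b 0 - a (Fin.castSucc 0)) *
        (a (Fin.last (l + 1)) + b (Fin.last l) - (b 0 + a (Fin.castSucc 0))) ≤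
        ∑ k, (b k - a k.castSucc) *
          (a (Fin.last (l + 1)) + b (Fin.last l) - (b k + a k.castSucc)) :=
      Finset.single_le_sum (f := fun k => (b k - a k.castSucc) *
          (a (Fin.last (l + 1)) + b (Fin.last l) - (b k + a k.castSucc)))
        (fun k _ => mul_nonneg (sub_nonneg.2 ((ha k.castSucc_lt_succ.le).trans (hab k))) (by
          have := ha (Fin.le_last k.castSucc)
          have := hb (Fin.le_last k)
          linarith)) (Finset.mem_univ _)
    have h2 : ∑ k, (b k - a k.castSucc) *
          (a (Fin.last (l + 1)) + b (Fin.last l) - (b k + a k.castSucc)) =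
        a (Fin.last (l + 1)) * (a (Fin.last (l + 1)) + b (Fin.last l)) -
          (∑ k, b k ^ 2 - ∑ k : Fin (l + 1), a k.castSucc ^ 2) := by
      rw [← hc, Finset.sum_mul, ← Finset.sum_sub_distrib, ← Finset.sum_sub_distrib, hc]
      exact Finset.sum_congr rfl fun k _ => by ring
    rw [Fin.castSucc_zero] at h1
    linarith

theorem eval_one_derivative_derivative_X_pow (a : ℕ) :
    (Polynomial.derivative (Polynomial.derivative (Polynomial.X ^ a : Polynomial ℤ))).eval 1 =
      a * (a - 1) := by
  cases a <;> simp [Polynomial.derivative_X_pow]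

namespace MinimalGradedFreeResolution

variable {K : Type*} [Field K] {n : ℕ} {I : Ideal (MvPolynomial (Fin n) K)}
  (F : MinimalGradedFreeResolution I)

theorem setOf_betti_ne_zero (i : ℕ) : {j | F.betti i j ≠ 0} = Set.range (F.shift i) := by
  ext j
  simp [betti, Finset.filter_eq_empty_iff]

theorem minShift_eq {i : ℕ} {k : Fin (F.rank i)} (h : ∀ k', F.shift i k ≤ F.shift i k') :
    F.minShift i = F.shift i k := by
  rw [minShift, setOf_betti_ne_zero]
  exact IsLeast.csInf_eq ⟨⟨k, rfl⟩, by rintro _ ⟨k', rfl⟩; exact h k'⟩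

theorem maxShift_eq {i : ℕ} {k : Fin (F.rank i)} (h : ∀ k', F.shift i k' ≤ F.shift i k) :
    F.maxShift i = F.shift i k := by
  rw [maxShift, setOf_betti_ne_zero]
  exact IsGreatest.csSup_eq ⟨⟨k, rfl⟩, by rintro _ ⟨k', rfl⟩; exact h k'⟩

/-- In increasing order, the `k`-th shift of `F₂` exceeds the `(k + 1)`-st shift of `F₁`. -/
theorem shift_lt_shift_of_sorted (h3 : F.rank 3 = 0) {σ : Equiv.Perm (Fin (F.rank 1))}
    {τ : Equiv.Perm (Fin (F.rank 2))} (hσ : Monotone (F.shift 1 ∘ σ))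
    (hτ : Monotone (F.shift 2 ∘ τ)) {i : Fin (F.rank 1)} {k : Fin (F.rank 2)}
    (hik : i.val = k.val + 1) : F.shift 1 (σ i) < F.shift 2 (τ k) := by
  -- Otherwise a nonzero entry in a column up to `k` and a row from `i` on would need positive
  -- degree where the shifts allow none, leaving `k + 1` columns supported on `i = k + 1` rows.
  by_contra! hle
  have h := F.card_lt_of_supported h3 ((Finset.Iio i).map σ.toEmbedding)
    ((Finset.Iic k).map τ.toEmbedding) (Finset.map_nonempty.2 ⟨k, by simp⟩) ?_
  · rw [Finset.card_map, Finset.card_map, Fin.card_Iio, Fin.card_Iic, hik] at h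
    exact lt_irrefl _ h
  · intro q hq p hp
    obtain ⟨q, rfl⟩ := σ.surjective q
    obtain ⟨p, hpk, rfl⟩ := Finset.mem_map.1 hp
    have hq' : i ≤ q := by simpa using hq
    by_contra hne
    have h1 : F.shift 1 (σ q) < F.shift 2 (τ p) := F.shift_lt_of_d_ne_zero hne
    have h2 : F.shift 1 (σ i) ≤ F.shift 1 (σ q) := hσ hq'
    have h4 : F.shift 2 (τ p) ≤ F.shift 2 (τ k) := hτ (Finset.mem_Iic.1 hpk)
    omega

/-- The double root kills the value and first derivative at 1, and the second derivative there is `2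
* Q.eval 1`. -/
theorem numerical_conditions (h3 : F.rank 3 = 0) {Q : Polynomial ℤ}
    (hQ : F.numerator = (1 - Polynomial.X) ^ 2 * Q) :
    F.rank 1 = F.rank 2 + 1 ∧ ∑ i, F.shift 1 i = ∑ k, F.shift 2 k ∧
      2 * Q.eval 1 = ∑ k, F.shift 2 k ^ 2 - ∑ i, F.shift 1 i ^ 2 := by
  have ha : ∀ i, ((F.shift 1 i).toNat : ℤ) = F.shift 1 i :=
    fun i => Int.toNat_of_nonneg (F.shift_one_pos i).le
  have hb : ∀ i, ((F.shift 2 i).toNat : ℤ) = F.shift 2 i :=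
    fun i => Int.toNat_of_nonneg (F.shift_two_pos h3 i).le
  have e0 := congrArg (Polynomial.eval 1) hQ
  have e1 := congrArg (fun p => Polynomial.eval 1 (Polynomial.derivative p)) hQ
  have e2 := congrArg
    (fun p => Polynomial.eval 1 (Polynomial.derivative (Polynomial.derivative p))) hQ
  simp only [numerator, map_add, map_sub, map_sum, Polynomial.derivative_one, Polynomial.eval_add,
    Polynomial.eval_sub, Polynomial.eval_finsetSum, eval_one_derivative_derivative_X_pow,
    ha, hb] at e0 e1 e2
  simp [ha, hb, pow_two, Polynomial.derivative_mul, Polynomial.derivative_X_pow] at e0 e1 e2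
  have hs : ∑ i, F.shift 1 i = ∑ k, F.shift 2 k := by linarith
  refine ⟨by omega, hs, ?_⟩
  simp only [mul_sub, mul_one, Finset.sum_sub_distrib, pow_two] at e2 ⊢
  linarith

end MinimalGradedFreeResolution

end GradedAlgebraBounds

theorem theorem1p2 {K : Type*} [Field K] {n : ℕ} (I : Ideal (MvPolynomial (Fin n) K))
    (hI : GradedAlgebraBounds.IsGraded I)
    (hCM : GradedAlgebraBounds.IsCohenMacaulay I)
    (hcodim : GradedAlgebraBounds.HasCodim I 2)
    (F : GradedAlgebraBounds.MinimalGradedFreeResolution I) :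
    ∃ e : ℤ, GradedAlgebraBounds.HasMultiplicity I e ∧
      (1 / 2 : ℚ) * F.minShift 1 * F.minShift 2
          + (1 / 2 : ℚ) * (F.maxShift 2 - F.maxShift 1)
            * (F.maxShift 2 - F.minShift 2 + F.maxShift 1 - F.minShift 1) ≤ (e : ℚ) ∧
      (e : ℚ) ≤ (1 / 2 : ℚ) * F.maxShift 1 * F.maxShift 2
          - (1 / 2 : ℚ) * (F.minShift 2 - F.minShift 1)
            * (F.maxShift 2 - F.minShift 2 + F.maxShift 1 - F.minShift 1) := by
  obtain ⟨rs, hrs, hreg, hdim⟩ := hCM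
  have hn : n = rs.length + 2 := by
    rw [GradedAlgebraBounds.HasCodim, hdim, MvPolynomial.ringKrullDim_of_isNoetherianRing,
      ringKrullDim_eq_zero_of_field, zero_add, Nat.card_eq_fintype_card, Fintype.card_fin] at hcodim
    exact_mod_cast hcodim.symm
  have h3 : F.rank 3 = 0 := F.rank_eq_zero hrs hreg.toIsWeaklyRegular (by omega)
  have hHS := F.one_sub_pow_mul_hilbertSeries h3
  obtain ⟨C, D, hCD⟩ := GradedAlgebraBounds.exists_sum_finrank_component_le hI hdim
  have hHS' : (1 - PowerSeries.X) ^ (rs.length + 2) * GradedAlgebraBounds.hilbertSeries I =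
      (F.numerator : PowerSeries ℤ) := hn ▸ hHS
  obtain ⟨Q, hQ⟩ := GradedAlgebraBounds.one_sub_X_sq_dvd_of_growth hHS' hCD
  obtain ⟨hrank, hsum, hsq⟩ := F.numerical_conditions h3 hQ
  refine ⟨Q.eval 1, ⟨rs.length, Q, hdim, ?_, rfl⟩, ?_⟩
  · have hne : (1 - PowerSeries.X : PowerSeries ℤ) ^ 2 ≠ 0 := by
      refine pow_ne_zero 2 fun h => ?_
      have := congrArg (PowerSeries.coeff 0) h
      simp at this
    refine mul_left_cancel₀ hne ?_
    rw [← mul_assoc, ← pow_add, add_comm 2, hHS', hQ]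
    simp
  -- If `F₂` were zero, `F₁` would have rank one and its positive shift would equal an empty sum.
  obtain ⟨l, hl⟩ : ∃ l, F.rank 2 = l + 1 := by
    refine Nat.exists_eq_succ_of_ne_zero fun h0 => ?_
    have hz : ∑ k, F.shift 2 k = 0 := Finset.sum_eq_zero fun k _ =>
      absurd (lt_of_lt_of_eq k.isLt h0) (Nat.not_lt_zero _)
    have hpos : 0 < ∑ i, F.shift 1 i := Finset.sum_pos (fun i _ => F.shift_one_pos i)
      ⟨⟨0, by omega⟩, Finset.mem_univ _⟩
    omega
  have hl' : F.rank 1 = l + 2 := by omega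
  let σ := Tuple.sort (F.shift 1)
  let τ := Tuple.sort (F.shift 2)
  have hσ : Monotone (F.shift 1 ∘ σ) := Tuple.monotone_sort _
  have hτ : Monotone (F.shift 2 ∘ τ) := Tuple.monotone_sort _
  let eσ : Fin (l + 2) ≃ Fin (F.rank 1) := (finCongr hl'.symm).trans σ
  let eτ : Fin (l + 1) ≃ Fin (F.rank 2) := (finCongr hl.symm).trans τ
  have ha : Monotone (F.shift 1 ∘ eσ) := fun i j hij =>
    hσ (show Fin.cast hl'.symm i ≤ Fin.cast hl'.symm j from hij)
  have hb : Monotone (F.shift 2 ∘ eτ) := fun i j hij =>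
    hτ (show Fin.cast hl.symm i ≤ Fin.cast hl.symm j from hij)
  have hbounds := GradedAlgebraBounds.sum_sq_sub_sum_sq_bounds ha hb
    (fun k => (F.shift_lt_shift_of_sorted h3 hσ hτ (by simp)).le)
    (by simpa [Equiv.sum_comp eσ (F.shift 1), Equiv.sum_comp eτ (F.shift 2)] using hsum)
  have hsa : ∑ i, (F.shift 1 ∘ eσ) i ^ 2 = ∑ i, F.shift 1 i ^ 2 :=
    Equiv.sum_comp eσ (fun i => F.shift 1 i ^ 2)
  have hsb : ∑ i, (F.shift 2 ∘ eτ) i ^ 2 = ∑ i, F.shift 2 i ^ 2 :=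
    Equiv.sum_comp eτ (fun i => F.shift 2 i ^ 2)
  have hm1 : F.minShift 1 = F.shift 1 (eσ 0) := F.minShift_eq fun i => by
    obtain ⟨i, rfl⟩ := eσ.surjective i
    exact ha (Fin.zero_le i)
  have hM1 : F.maxShift 1 = F.shift 1 (eσ (Fin.last (l + 1))) := F.maxShift_eq fun i => by
    obtain ⟨i, rfl⟩ := eσ.surjective i
    exact ha (Fin.le_last i)
  have hm2 : F.minShift 2 = F.shift 2 (eτ 0) := F.minShift_eq fun i => by
    obtain ⟨i, rfl⟩ := eτ.surjective i
    exact hb (Fin.zero_le i)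
  have hM2 : F.maxShift 2 = F.shift 2 (eτ (Fin.last l)) := F.maxShift_eq fun i => by
    obtain ⟨i, rfl⟩ := eτ.surjective i
    exact hb (Fin.le_last i)
  rw [hsa, hsb, ← hsq] at hbounds
  simp only [Function.comp_apply, ← hm1, ← hM1, ← hm2, ← hM2] at hbounds
  obtain ⟨hlow, hupp⟩ := hbounds
  have hlow' := (Int.cast_le (R := ℚ)).2 hlow
  have hupp' := (Int.cast_le (R := ℚ)).2 hupp
  push_cast at hlow' hupp'
  constructor <;> linarith
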